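/- Let $X$ be a complex Banach space and let $(S(t))_{t\ge 0}\subset\mathscr L(X)$ be a locally bounded, strongly measurable semigroup of bounded linear operators on $X$ (so $S(0)=\mathrm{id}_X$ and $S(t+r)=S(t)S(r)$; strong continuity at $0$ is not assumed) with generator $-A\colon \mathsf D(A)\subseteq X\to X$, i.e. for all $z\in\mathbb C$ with sufficiently large real part, $z+A\colon\mathsf D(A)\to X$ is bijective with inverse $(z+A)^{-1}x=\int_0^\infty e^{-zt}S(t)x\,\mathrm dt$ for all $x\in X$. Suppose that the semigroup is uniformly exponentially stable: there are $M_0\in[1,\infty)$ and $w\in(0,\infty)$ such that $\|S(t)\|_{\mathscr L(X)}\le M_0e^{-wt}$ for all $t\ge 0$. For $s\in(0,\infty)$ and $u\colon\mathbb R\to X$ put $$\mathfrak I^s u(t):=\frac1{\Gamma(s)}\int_0^\infty \tau^{s-1}S(\tau)u(t-\tau)\,\mathrm d\tau$$ whenever this Bochner integral converges for a.e. $t\in\mathbb R$, and put $\mathfrak I^0u:=u$. Let $p\in[1,\infty]$. View $\partial_t+A$, $[(\partial_t+A)u](t)=\partial_tu(t)+Au(t)$, as an operator on $L^p(\mathbb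 R;X)$ with domain $W^{1,p}(\mathbb R;X)\cap L^p(\mathbb R;\mathsf D(A))$, where $\partial_t$ is the weak derivative and $\mathsf D(A)$ carries the graph norm; its powers $(\partial_t+A)^n$, $n\in\mathbb N_0$, have their natural domains. For $s\in[0,\infty)$ define $$\mathfrak D^su:=(\partial_t+A)^{\lceil s\rceil}\mathfrak I^{\lceil s\rceil-s}u,\qquad \mathsf D(\mathfrak D^s):=\{u\in L^p(\mathbb R;X):\ \mathfrak I^{\lceil s\rceil-s}u\in\mathsf D((\partial_t+A)^{\lceil s\rceil})\}.$$ Proposition. Let $s\in[0,\infty)$, $p\in[1,\infty]$ and $u\in L^p(\mathbb R;X)$. Then $\mathfrak I^su$ is well defined (if $s>0$, the defining integral converges for a.e. $t\in\mathbb R$), and the following assertions hold: (a) If $\mathfrak I^su\in\mathsf D(\mathfrak D^s)$, then $\mathfrak D^s\mathfrak I^su=u$ a.e. (b) If $u\in\mathsf D(\mathfrak D^s)$, then $\mathfrak I^s\mathfrak D^su$ is well defined and $\mathfrak I^s\mathfrak D^su=u$ a.e. -/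

import Mathlib

open MeasureTheory Set
open scoped ENNReal ContDiff

noncomputable section

namespace FracParabolic

variable {X : Type*} [NormedAddCommGroup X] [NormedSpace ℂ X]

/-- `(S(t))_{t ≥ 0}` is a locally bounded, strongly measurable semigroup of bounded linear
operators on `X`. Only the values `S t` with `0 ≤ t` matter. Strong measurability of the orbits
is measurability in the Bochner sense with respect to Lebesgue measure; continuity of the orbits
at `0` is not required. -/
structure IsMeasurableSemigroup (S : ℝ → X →L[ℂ] X) : Prop where
  zero : S 0 = ContinuousLinearMap.id ℂ X
  add : ∀ t r : ℝ, 0 ≤ t → 0 ≤ r → S (t + r) = (S t).comp (S r)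
  measurable : ∀ x : X, AEStronglyMeasurable (fun t => S t x) (volume.restrict (Ici 0))
  locallyBounded : ∀ T : ℝ, ∃ C : ℝ, ∀ t ∈ Icc 0 T, ‖S t‖ ≤ C

/-- Uniform exponential stability: `‖S(t)‖ ≤ M₀ e^{-wt}` for all `t ≥ 0`, with `M₀ ≥ 1`,
`w > 0`. -/
def IsExpStable (S : ℝ → X →L[ℂ] X) : Prop :=
  ∃ M₀ w : ℝ, 1 ≤ M₀ ∧ 0 < w ∧ ∀ t : ℝ, 0 ≤ t → ‖S t‖ ≤ M₀ * Real.exp (-w * t)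

/-- The linear operator `B : D(B) ⊆ X → X` is the generator of the measurable semigroup `S`: for
all `z ∈ ℂ` with sufficiently large real part, `z - B : D(B) → X` is bijective and its inverse is
the Laplace transform `x ↦ ∫₀^∞ e^{-zt} S(t) x dt`. (For strongly continuous semigroups this is
the usual infinitesimal generator; without strong continuity at `0` the domain of `B` need not be
dense.) -/
def IsGenerator (B : X →ₗ.[ℂ] X) (S : ℝ → X →L[ℂ] X) : Prop :=
  ∃ a : ℝ, ∀ z : ℂ, a < z.re → ∀ x : X,
    IntegrableOn (fun t : ℝ => Complex.exp (-z * (t : ℂ)) • S t x) (Ioi 0) ∧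
    ∀ y : X, (∃ hy : y ∈ B.domain, z • y - B ⟨y, hy⟩ = x) ↔
      y = ∫ t in Ioi (0 : ℝ), Complex.exp (-z * (t : ℂ)) • S t x

/-- The integral defining the fractional parabolic integral of order `s` of `u` at the time `t`
converges for almost every `t` (nothing is required for `s = 0`). -/
def FracIntConverges (S : ℝ → X →L[ℂ] X) (s : ℝ) (u : ℝ → X) : Prop :=
  s = 0 ∨ ∀ᵐ t : ℝ, IntegrableOn (fun τ : ℝ => τ ^ (s - 1) • S τ (u (t - τ))) (Ioi 0)

/-- The Riemann–Liouville type fractional parabolic integral of order `s ≥ 0`,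
`𝓘ˢ u (t) = (1 / Γ(s)) ∫₀^∞ τ^{s-1} S(τ) u(t - τ) dτ` for `s > 0`, and `𝓘⁰ u = u`. -/
def fracInt (S : ℝ → X →L[ℂ] X) (s : ℝ) (u : ℝ → X) (t : ℝ) : X :=
  if s = 0 then u t
  else (1 / Real.Gamma s) • ∫ τ in Ioi (0 : ℝ), τ ^ (s - 1) • S τ (u (t - τ))

/-- `v` is the weak derivative of `u` on `ℝ`. Used for `u` and `v` in `L^p(ℝ; X)`, `1 ≤ p`, which
are locally integrable. -/
def HasWeakDeriv (u v : ℝ → X) : Prop :=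
  ∀ φ : ℝ → ℝ, ContDiff ℝ ∞ φ → HasCompactSupport φ →
    ∫ t, deriv φ t • u t = - ∫ t, φ t • v t

/-- The graph of the operator `∂_t + A` in `L^p(ℝ; X)`, with functions taken up to almost
everywhere equality: `u` lies in `W^{1,p}(ℝ; X) ∩ L^p(ℝ; D(A))`, where `D(A)` carries the graph
norm, and `f = ∂_t u + A u` almost everywhere. Here `u'` is the weak derivative of `u` and `g` is
`t ↦ A (u t)`. -/
def IsParabolic (A : X →ₗ.[ℂ] X) (p : ℝ≥0∞) (u f : ℝ → X) : Prop :=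
  MemLp u p volume ∧
  ∃ u' g : ℝ → X,
    (MemLp u' p volume ∧ HasWeakDeriv u u') ∧
    (MemLp g p volume ∧ ∀ᵐ t, ∃ ht : u t ∈ A.domain, A ⟨u t, ht⟩ = g t) ∧
    ∀ᵐ t, f t = u' t + g t

/-- The graph of the power `(∂_t + A)ⁿ` in `L^p(ℝ; X)`, with the natural domain: `(∂_t + A)⁰` is
the identity on `L^p(ℝ; X)`, and `u ∈ D((∂_t + A)ⁿ⁺¹)` means that `u ∈ D(∂_t + A)` and
`(∂_t + A) u ∈ D((∂_t + A)ⁿ)`. -/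
def IsParabolicPow (A : X →ₗ.[ℂ] X) (p : ℝ≥0∞) : ℕ → (ℝ → X) → (ℝ → X) → Prop
  | 0, u, f => MemLp u p volume ∧ f =ᵐ[volume] u
  | n + 1, u, f => ∃ g : ℝ → X, IsParabolic A p u g ∧ IsParabolicPow A p n g f

/-- The graph of the Riemann–Liouville type fractional parabolic derivative
`𝓓ˢ = (∂_t + A)^⌈s⌉ 𝓘^(⌈s⌉ - s)` in `L^p(ℝ; X)`: the function `u ∈ L^p(ℝ; X)` lies in the domain
of `𝓓ˢ`, that is, `𝓘^(⌈s⌉ - s) u ∈ D((∂_t + A)^⌈s⌉)`, and `𝓓ˢ u = f` almost everywhere. -/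
def IsFracDeriv (A : X →ₗ.[ℂ] X) (S : ℝ → X →L[ℂ] X) (p : ℝ≥0∞) (s : ℝ) (u f : ℝ → X) : Prop :=
  MemLp u p volume ∧
  FracIntConverges S ((⌈s⌉₊ : ℝ) - s) u ∧
  IsParabolicPow A p ⌈s⌉₊ (fracInt S ((⌈s⌉₊ : ℝ) - s) u) f

/-- The domain of `𝓓ˢ` in `L^p(ℝ; X)`. -/
def InDomFracDeriv (A : X →ₗ.[ℂ] X) (S : ℝ → X →L[ℂ] X) (p : ℝ≥0∞) (s : ℝ) (u : ℝ → X) : Prop :=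
  ∃ f : ℝ → X, IsFracDeriv A S p s u f

theorem IsParabolic.congr {A : X →ₗ.[ℂ] X} {p : ℝ≥0∞} {u v f g : ℝ → X}
    (h : IsParabolic A p u f) (huv : u =ᵐ[volume] v) (hfg : f =ᵐ[volume] g) :
    IsParabolic A p v g := by
  obtain ⟨hu, u', w, ⟨hu', hd⟩, ⟨hw, hA⟩, hf⟩ := h
  refine ⟨(memLp_congr_ae huv).1 hu, u', w, ⟨hu', ?_⟩, ⟨hw, ?_⟩, ?_⟩
  · intro φ h1 h2
    rw [← hd φ h1 h2]
    refine integral_congr_ae ?_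
    filter_upwards [huv] with t ht
    rw [ht]
  · filter_upwards [hA, huv] with t ⟨h1, h2⟩ ht
    rw [← ht]
    exact ⟨h1, h2⟩
  · filter_upwards [hf, hfg] with t h1 h2
    rw [← h2, h1]

/-- `∂_t + A` is single-valued up to almost everywhere equality. -/
theorem IsParabolic.unique [CompleteSpace X] {A : X →ₗ.[ℂ] X} {p : ℝ≥0∞} (hp : 1 ≤ p)
    {u f g : ℝ → X} (hf : IsParabolic A p u f) (hg : IsParabolic A p u g) :
    f =ᵐ[volume] g := by
  obtain ⟨_, u', w, ⟨hu', hd⟩, ⟨_, hA⟩, hf⟩ := hf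
  obtain ⟨_, v', w', ⟨hv', hd'⟩, ⟨_, hA'⟩, hg⟩ := hg
  have key : u' =ᵐ[volume] v' := by
    refine ae_eq_of_integral_contDiff_smul_eq (hu'.locallyIntegrable hp)
      (hv'.locallyIntegrable hp) fun φ h1 h2 => ?_
    have := (hd φ h1 h2).symm.trans (hd' φ h1 h2)
    exact neg_injective this
  filter_upwards [key, hA, hA', hf, hg] with t h1 ⟨_, h2⟩ ⟨_, h3⟩ h4 h5
  rw [h4, h5, h1, ← h2, ← h3]

theorem IsParabolicPow.unique [CompleteSpace X] {A : X →ₗ.[ℂ] X} {p : ℝ≥0∞} (hp : 1 ≤ p)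
    (n : ℕ) : ∀ {u v f g : ℝ → X}, u =ᵐ[volume] v → IsParabolicPow A p n u f →
      IsParabolicPow A p n v g → f =ᵐ[volume] g := by
  induction n with
  | zero => exact fun huv hf hg => hf.2.trans (huv.trans hg.2.symm)
  | succ n ih =>
    rintro u v f g huv ⟨k, hk, hf⟩ ⟨l, hl, hg⟩
    exact ih ((hk.congr huv (Filter.EventuallyEq.refl _ _)).unique hp hl) hf hg

/-- `𝓓ˢ` is single-valued: `𝓓ˢ u` is determined by `u` up to almost everywhere equality. -/
theorem IsFracDeriv.unique [CompleteSpace X] {A : X →ₗ.[ℂ] X} {S : ℝ → X →L[ℂ] X} {p : ℝ≥0∞}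
    (hp : 1 ≤ p) {s : ℝ} {u f g : ℝ → X} (hf : IsFracDeriv A S p s u f)
    (hg : IsFracDeriv A S p s u g) : f =ᵐ[volume] g :=
  IsParabolicPow.unique hp _ (Filter.EventuallyEq.refl _ _) hf.2.2 hg.2.2

open Classical in
/-- The Riemann–Liouville type fractional parabolic derivative `𝓓ˢ u` of a function `u` in the
domain of `𝓓ˢ` in `L^p(ℝ; X)` (a representative of it), with the value `0` off the domain. -/
def fracDeriv (A : X →ₗ.[ℂ] X) (S : ℝ → X →L[ℂ] X) (p : ℝ≥0∞) (s : ℝ) (u : ℝ → X) : ℝ → X :=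
  if h : InDomFracDeriv A S p s u then h.choose else 0

/-- On its domain, `fracDeriv` is the value of `𝓓ˢ`. -/
theorem isFracDeriv_fracDeriv {A : X →ₗ.[ℂ] X} {S : ℝ → X →L[ℂ] X} {p : ℝ≥0∞} {s : ℝ}
    {u : ℝ → X} (h : InDomFracDeriv A S p s u) :
    IsFracDeriv A S p s u (fracDeriv A S p s u) := by
  unfold fracDeriv
  rw [dif_pos h]
  exact h.choose_spec

end FracParabolic

end

/-! Write `n = ⌈s⌉` and let `J x = ∫ T(τ) x dτ`, where `T` is `S` extended by zero to `τ ≤ 0`; `J`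
is the inverse of `A`. Everything follows from three facts: `𝓘ᵃ 𝓘ᵇ = 𝓘ᵃ⁺ᵇ`, `𝓘¹ (∂_t + A) v = v`,
and injectivity of every `𝓘ᵃ`. For (a), `𝓘ⁿ 𝓓ˢ 𝓘ˢ u = 𝓘ⁿ⁻ˢ 𝓘ˢ u = 𝓘ⁿ u`, and `𝓘ⁿ` is cancelled. For
(b), `𝓘ⁿ⁻ˢ 𝓘ˢ 𝓓ˢ u = 𝓘ⁿ 𝓓ˢ u = 𝓘ⁿ⁻ˢ u`, and `𝓘ⁿ⁻ˢ` is cancelled.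

All of this takes place in `L¹` with weight `e^{-δ|t|}`, `2δ = w`, which contains every `L^p` and is
stable under each `𝓘ᵃ`. There the index law (`fracInt_fracInt`) is Fubini combined with the Beta
integral.

Without strong continuity, the resolvent identity at one large real point replaces differentiation
of orbits: it makes `J` injective and gives `J A y = y`. Injectivity of `J` then carries the other
two facts. If `𝓘¹ g = 0`, applying `T(r)` at time `t - r` kills every tail `∫_r^∞ T(τ) g(t-τ) dτ`,
so `T(τ) g = 0` almost everywhere and `J g = 0` (`ae_eq_zero_of_kernelConv_one`). The left inverse
property is checked after applying `J`, which turns `T(τ)` into `∫_τ^∞ T(σ) dσ` and hence `v'` into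
differences of `v` (`kernelConv_one_add_of_weakDeriv`). -/

noncomputable section

namespace FracParabolic

/-! ### Exponentially weighted `L¹` and scalar kernels -/

section Weighted

variable {E : Type*} [NormedAddCommGroup E] [NormedSpace ℝ E]

/-- Integrability on `ℝ` with respect to the weight `e^{-δ|t|}`. -/
def WeightedIntegrable (δ : ℝ) (u : ℝ → E) : Prop :=
  Integrable (fun t => Real.exp (-δ * |t|) • u t)

theorem WeightedIntegrable.aestronglyMeasurable {δ : ℝ} {u : ℝ → E}
    (hu : WeightedIntegrable δ u) : AEStronglyMeasurable u volume := by
  have h : AEStronglyMeasurable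
      (fun t => Real.exp (δ * |t|) • Real.exp (-δ * |t|) • u t) volume :=
    AEStronglyMeasurable.smul (by fun_prop) hu.1
  refine h.congr (Filter.Eventually.of_forall fun t => ?_)
  simp only [smul_smul, ← Real.exp_add]
  simp

theorem WeightedIntegrable.congr {δ : ℝ} {u v : ℝ → E} (hu : WeightedIntegrable δ u)
    (h : u =ᵐ[volume] v) : WeightedIntegrable δ v :=
  Integrable.congr hu (by filter_upwards [h] with t ht; rw [ht])

theorem WeightedIntegrable.add {δ : ℝ} {u v : ℝ → E} (hu : WeightedIntegrable δ u)
    (hv : WeightedIntegrable δ v) : WeightedIntegrable δ (fun t => u t + v t) :=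
  (Integrable.add hu hv).congr (Filter.Eventually.of_forall fun t => by simp [smul_add])

theorem WeightedIntegrable.sub {δ : ℝ} {u v : ℝ → E} (hu : WeightedIntegrable δ u)
    (hv : WeightedIntegrable δ v) : WeightedIntegrable δ (fun t => u t - v t) :=
  (Integrable.sub hu hv).congr (Filter.Eventually.of_forall fun t => by simp [smul_sub])

theorem integrable_exp_neg_mul_abs {δ : ℝ} (hδ : 0 < δ) :
    Integrable (fun t : ℝ => Real.exp (-δ * |t|)) := by
  have h1 : IntegrableOn (fun t : ℝ => Real.exp (-δ * t)) (Ioi 0) :=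
    integrableOn_exp_mul_Ioi (by linarith) 0
  have h2 : IntegrableOn (fun t : ℝ => Real.exp (δ * t)) (Iic 0) :=
    integrableOn_exp_mul_Iic hδ 0
  rw [← integrableOn_univ, ← Iic_union_Ioi (a := (0 : ℝ))]
  refine IntegrableOn.union (h2.congr_fun (fun t ht => ?_) measurableSet_Iic)
    (h1.congr_fun (fun t ht => ?_) measurableSet_Ioi)
  · simp only [abs_of_nonpos (mem_Iic.1 ht)]; ring_nf
  · simp only [abs_of_pos (mem_Ioi.1 ht)]

/-- Admitting constant functions makes identities for Laplace transforms of a single orbit special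
cases of convolution identities. -/
theorem weightedIntegrable_const {δ : ℝ} (hδ : 0 < δ) (x : E) :
    WeightedIntegrable δ (fun _ => x) :=
  (integrable_exp_neg_mul_abs hδ).smul_const x

/-- For finite `p` the bound `‖u‖ ≤ 1 + ‖u‖^p`, used with a weight at most one, replaces Hölder's
inequality; for `p = ∞` the weight itself is integrable. -/
theorem _root_.MeasureTheory.MemLp.weightedIntegrable {δ : ℝ} (hδ : 0 < δ) {p : ℝ≥0∞}
    (hp : 1 ≤ p) {u : ℝ → E} (hu : MemLp u p volume) : WeightedIntegrable δ u := by
  have hm : AEStronglyMeasurable (fun t => Real.exp (-δ * |t|) • u t) volume :=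
    AEStronglyMeasurable.smul (by fun_prop) hu.1
  have hw := integrable_exp_neg_mul_abs hδ
  rcases eq_or_ne p ∞ with rfl | hp'
  · refine (hw.mul_const (eLpNorm u ∞ volume).toReal).mono' hm ?_
    filter_upwards [ae_le_eLpNormEssSup (f := u) (μ := volume)] with t ht
    rw [← eLpNorm_exponent_top] at ht
    have ht : ‖u t‖ ≤ (eLpNorm u ∞ volume).toReal := by
      simpa using ENNReal.toReal_mono hu.2.ne ht
    rw [norm_smul, Real.norm_of_nonneg (Real.exp_pos _).le]
    gcongr
  · have hp0 : p ≠ 0 := (zero_lt_one.trans_le hp).ne'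
    have hp1 : 1 ≤ p.toReal := by
      rw [← ENNReal.toReal_one]
      exact ENNReal.toReal_mono hp' hp
    refine (hw.add (hu.integrable_norm_rpow hp0 hp')).mono' hm
      (Filter.Eventually.of_forall fun t => ?_)
    rw [norm_smul, Real.norm_of_nonneg (Real.exp_pos _).le, Pi.add_apply]
    have h1 : Real.exp (-δ * |t|) ≤ 1 := Real.exp_le_one_iff.2 (by
      have := mul_nonneg hδ.le (abs_nonneg t); linarith)
    have h0 := (Real.exp_pos (-δ * |t|)).le
    rcases le_total ‖u t‖ 1 with h | h
    · have := Real.rpow_nonneg (norm_nonneg (u t)) p.toReal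
      nlinarith [norm_nonneg (u t)]
    · have := Real.self_le_rpow_of_one_le h hp1
      nlinarith [norm_nonneg (u t)]

/-- Since `|t - τ| ≤ |t| + τ` for `τ > 0`, a factor `e^{-δτ}` pays for translating the weight, and
an ordinary `L¹` convolution integrand dominates. -/
theorem WeightedIntegrable.integrable_shear {δ : ℝ} (hδ : 0 ≤ δ) {a : ℝ → ℝ}
    (ha : Integrable a) (ha0 : ∀ τ ≤ 0, a τ = 0) {u : ℝ → E} (hu : WeightedIntegrable δ u) :
    Integrable (fun q : ℝ × ℝ =>
      (Real.exp (-δ * |q.1|) * (Real.exp (-δ * q.2) * a q.2)) • u (q.1 - q.2))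
      (volume.prod volume) := by
  have h := ha.convolution_integrand (ContinuousLinearMap.lsmul ℝ ℝ : ℝ →L[ℝ] E →L[ℝ] E) hu
  have hum : AEStronglyMeasurable (fun q : ℝ × ℝ => u (q.1 - q.2)) (volume.prod volume) :=
    hu.aestronglyMeasurable.comp_quasiMeasurePreserving
      (quasiMeasurePreserving_sub_of_right_invariant volume volume)
  have ham : AEStronglyMeasurable (fun q : ℝ × ℝ => a q.2) (volume.prod volume) := ha.1.comp_snd
  refine h.mono (AEStronglyMeasurable.smul ((AEStronglyMeasurable.mul (by fun_prop)
    (AEStronglyMeasurable.mul (by fun_prop) ham))) hum) (Filter.Eventually.of_forall fun q => ?_)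
  rcases le_or_gt q.2 0 with hq | hq
  · simp [ha0 _ hq]
  · simp only [ContinuousLinearMap.lsmul_apply, norm_smul, norm_mul,
      Real.norm_of_nonneg (Real.exp_pos _).le]
    have : Real.exp (-δ * |q.1|) * Real.exp (-δ * q.2) ≤ Real.exp (-δ * |q.1 - q.2|) := by
      rw [← Real.exp_add]
      refine Real.exp_le_exp.2 ?_
      have h1 : |q.1 - q.2| ≤ |q.1| + q.2 := by
        simpa [abs_of_pos hq] using abs_sub q.1 q.2
      nlinarith
    calc _ = (Real.exp (-δ * |q.1|) * Real.exp (-δ * q.2)) * (‖a q.2‖ * ‖u (q.1 - q.2)‖) := by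
          ring
      _ ≤ Real.exp (-δ * |q.1 - q.2|) * (‖a q.2‖ * ‖u (q.1 - q.2)‖) := by gcongr
      _ = _ := by ring

/-- Scalar kernels on `(0, ∞)`, extended by zero, that are integrable with respect to `e^{-δτ}`. -/
def IsKernel (δ : ℝ) (k : ℝ → ℝ) : Prop :=
  (∀ τ ≤ 0, k τ = 0) ∧ Integrable (fun τ => Real.exp (-δ * τ) * k τ)

theorem IsKernel.aestronglyMeasurable {δ : ℝ} {k : ℝ → ℝ} (hk : IsKernel δ k) :
    AEStronglyMeasurable k volume := by
  have h : AEStronglyMeasurable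
      (fun t => Real.exp (δ * t) * (Real.exp (-δ * t) * k t)) volume :=
    AEStronglyMeasurable.mul (by fun_prop) hk.2.1
  refine h.congr (Filter.Eventually.of_forall fun t => ?_)
  simp only [← mul_assoc, ← Real.exp_add]
  simp

theorem IsKernel.abs {δ : ℝ} {k : ℝ → ℝ} (hk : IsKernel δ k) : IsKernel δ (fun τ => |k τ|) :=
  ⟨fun τ hτ => by simp [hk.1 τ hτ], hk.2.norm.congr (Filter.Eventually.of_forall fun τ => by
    simp)⟩

theorem IsKernel.integrable_conv {δ : ℝ} {k l : ℝ → ℝ} (hk : IsKernel δ k) (hl : IsKernel δ l) :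
    Integrable (fun q : ℝ × ℝ => Real.exp (-δ * q.1) * (k q.2 * l (q.1 - q.2)))
      (volume.prod volume) := by
  refine (hk.2.convolution_integrand (ContinuousLinearMap.mul ℝ ℝ) hl.2).congr
    (Filter.Eventually.of_forall fun q => ?_)
  have : Real.exp (-δ * q.1) = Real.exp (-δ * q.2) * Real.exp (-δ * (q.1 - q.2)) := by
    rw [← Real.exp_add]; ring_nf
  simp only [ContinuousLinearMap.mul_apply', this]
  ring

theorem IsKernel.conv {δ : ℝ} {k l : ℝ → ℝ} (hk : IsKernel δ k) (hl : IsKernel δ l) :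
    IsKernel δ (fun ρ => ∫ τ, k τ * l (ρ - τ)) := by
  refine ⟨fun ρ hρ => ?_, ?_⟩
  · refine integral_eq_zero_of_ae (Filter.Eventually.of_forall fun τ => ?_)
    rcases le_or_gt τ 0 with h | h
    · simp [hk.1 τ h]
    · simp [hl.1 (ρ - τ) (by linarith)]
  · refine (hk.integrable_conv hl).integral_prod_left.congr
      (Filter.Eventually.of_forall fun ρ => ?_)
    exact integral_const_mul (Real.exp (-δ * ρ)) fun τ => k τ * l (ρ - τ)

end Weighted

/-! ### Convolution with operator kernels `k(τ) T(τ)` -/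

section Decay

variable {X : Type*} [NormedAddCommGroup X] [NormedSpace ℝ X]

/-- A measurable semigroup with exponential bound `M e^{-2δτ}`, extended by zero to `τ ≤ 0`. -/
structure IsDecaySemigroup (T : ℝ → X →L[ℝ] X) (M δ : ℝ) : Prop where
  pos : 0 < δ
  zero : ∀ τ ≤ 0, T τ = 0
  add : ∀ τ σ : ℝ, 0 < τ → 0 < σ → T (τ + σ) = (T τ).comp (T σ)
  meas : ∀ x : X, AEStronglyMeasurable (fun τ => T τ x) volume
  bound : ∀ τ : ℝ, ‖T τ‖ ≤ M * Real.exp (-(2 * δ) * τ)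

/-- The convolution of `u` with the operator kernel `τ ↦ k(τ) T(τ)`. -/
def kernelConv (T : ℝ → X →L[ℝ] X) (k : ℝ → ℝ) (u : ℝ → X) (t : ℝ) : X :=
  ∫ τ, k τ • T τ (u (t - τ))

variable {T : ℝ → X →L[ℝ] X} {M δ : ℝ}

/-- Only orbits are measurable, not `T` in operator norm, so `u` is approximated by simple functions
and continuity of each `T(τ)` passes to the limit. -/
theorem IsDecaySemigroup.aestronglyMeasurable_prod (hT : IsDecaySemigroup T M δ) {u : ℝ → X}
    (hu : AEStronglyMeasurable u volume) :
    AEStronglyMeasurable (fun q : ℝ × ℝ => T q.2 (u q.1)) (volume.prod volume) := by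
  have hsimple : ∀ f : SimpleFunc ℝ X,
      AEStronglyMeasurable (fun q : ℝ × ℝ => T q.2 (f q.1)) (volume.prod volume) := by
    intro f
    induction f using SimpleFunc.induction with
    | const c hs =>
      rename_i s
      have h : AEStronglyMeasurable (fun q : ℝ × ℝ => T q.2 c) (volume.prod volume) :=
        (hT.meas c).comp_snd
      have h2 := h.indicator (measurable_fst hs : MeasurableSet (Prod.fst ⁻¹' s : Set (ℝ × ℝ)))
      refine h2.congr (Filter.Eventually.of_forall fun q => ?_)
      by_cases hq : q.1 ∈ s <;> simp [indicator, hq]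
    | add hd hf hg =>
      refine (hf.add hg).congr (Filter.Eventually.of_forall fun q => ?_)
      simp
  have h1 : AEStronglyMeasurable (fun q : ℝ × ℝ => T q.2 (hu.mk u q.1)) (volume.prod volume) := by
    refine aestronglyMeasurable_of_tendsto_ae Filter.atTop
      (fun n => hsimple (hu.stronglyMeasurable_mk.approx n)) (Filter.Eventually.of_forall fun q => ?_)
    exact ((T q.2).continuous.tendsto _).comp (hu.stronglyMeasurable_mk.tendsto_approx q.1)
  refine h1.congr ?_
  filter_upwards [Measure.quasiMeasurePreserving_fst.ae hu.ae_eq_mk] with q hq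
  rw [hq]

theorem IsDecaySemigroup.aestronglyMeasurable_shear (hT : IsDecaySemigroup T M δ) {u : ℝ → X}
    (hu : AEStronglyMeasurable u volume) :
    AEStronglyMeasurable (fun q : ℝ × ℝ => T q.2 (u (q.1 - q.2))) (volume.prod volume) :=
  AEStronglyMeasurable.comp_quasiMeasurePreserving (f := fun q : ℝ × ℝ => (q.1 - q.2, q.2))
    (hT.aestronglyMeasurable_prod hu)
    (measurePreserving_sub_prod volume volume).quasiMeasurePreserving

theorem IsDecaySemigroup.norm_apply_le (hT : IsDecaySemigroup T M δ) (τ : ℝ) (x : X) :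
    ‖T τ x‖ ≤ M * Real.exp (-(2 * δ) * τ) * ‖x‖ :=
  (T τ).le_of_opNorm_le (hT.bound τ) x

theorem IsDecaySemigroup.nonneg (hT : IsDecaySemigroup T M δ) : 0 ≤ M := by
  simpa using (norm_nonneg _).trans (hT.bound 0)

/-- The decay `e^{-2δτ}` is split in two: one half makes `k` integrable, the other shifts the
weight. -/
theorem IsDecaySemigroup.integrable_prod (hT : IsDecaySemigroup T M δ) {k : ℝ → ℝ}
    (hk : IsKernel δ k) {u : ℝ → X} (hu : WeightedIntegrable δ u) :
    Integrable (fun q : ℝ × ℝ => Real.exp (-δ * |q.1|) • k q.2 • T q.2 (u (q.1 - q.2)))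
      (volume.prod volume) := by
  have h := (hu.integrable_shear hT.pos.le hk.2
    (fun τ hτ => by rw [hk.1 τ hτ, mul_zero])).norm.const_mul M
  refine h.mono' (AEStronglyMeasurable.smul (by fun_prop)
    (hk.aestronglyMeasurable.comp_snd.smul
      (hT.aestronglyMeasurable_shear hu.aestronglyMeasurable)))
    (Filter.Eventually.of_forall fun q => ?_)
  simp only [norm_smul, norm_mul, Real.norm_of_nonneg (Real.exp_pos _).le]
  have h2 := hT.norm_apply_le q.2 (u (q.1 - q.2))
  have h3 : Real.exp (-(2 * δ) * q.2) = Real.exp (-δ * q.2) * Real.exp (-δ * q.2) := by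
    rw [← Real.exp_add]; ring_nf
  calc _ ≤ Real.exp (-δ * |q.1|) *
        (‖k q.2‖ * (M * Real.exp (-(2 * δ) * q.2) * ‖u (q.1 - q.2)‖)) := by
        gcongr
    _ = _ := by rw [h3]; ring

theorem IsDecaySemigroup.ae_integrable (hT : IsDecaySemigroup T M δ) {k : ℝ → ℝ}
    (hk : IsKernel δ k) {u : ℝ → X} (hu : WeightedIntegrable δ u) :
    ∀ᵐ t : ℝ, Integrable (fun τ => k τ • T τ (u (t - τ))) := by
  filter_upwards [(hT.integrable_prod hk hu).prod_right_ae] with t ht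
  exact (integrable_smul_iff (Real.exp_pos _).ne' _).1 ht

theorem IsDecaySemigroup.weightedIntegrable_kernelConv (hT : IsDecaySemigroup T M δ) {k : ℝ → ℝ}
    (hk : IsKernel δ k) {u : ℝ → X} (hu : WeightedIntegrable δ u) :
    WeightedIntegrable δ (kernelConv T k u) := by
  refine (hT.integrable_prod hk hu).integral_prod_left.congr
    (Filter.Eventually.of_forall fun t => ?_)
  exact integral_smul (Real.exp (-δ * |t|)) fun τ => k τ • T τ (u (t - τ))

theorem ae_comp_sub_left {P : ℝ → Prop} (h : ∀ᵐ r : ℝ, P r) (t : ℝ) : ∀ᵐ τ : ℝ, P (t - τ) :=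
  (quasiMeasurePreserving_sub_left volume t).ae h

theorem kernelConv_congr {k : ℝ → ℝ} {u v : ℝ → X} (h : u =ᵐ[volume] v) :
    kernelConv T k u = kernelConv T k v := by
  funext t
  refine integral_congr_ae ?_
  filter_upwards [ae_comp_sub_left h t] with τ hτ
  rw [hτ]

/-- After substituting `ρ - τ` for the inner variable, `T(τ) T(ρ - τ) = T(ρ)` leaves only the scalar
kernels to be convolved. -/
theorem IsDecaySemigroup.kernelConv_kernelConv [CompleteSpace X] (hT : IsDecaySemigroup T M δ)
    {k l : ℝ → ℝ} (hk : IsKernel δ k) (hl : IsKernel δ l) {u : ℝ → X}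
    (hu : WeightedIntegrable δ u) :
    kernelConv T k (kernelConv T l u) =ᵐ[volume]
      kernelConv T (fun ρ => ∫ τ, k τ * l (ρ - τ)) u := by
  have hmeas := hT.aestronglyMeasurable_shear hu.aestronglyMeasurable
  -- The kernel `|k| * |l|` is again admissible, which gives the absolute integrability that Fubini
  -- needs at fixed `t`.
  filter_upwards [hT.ae_integrable (hk.abs.conv hl.abs) hu, hmeas.prodMk_left] with t ht hmt
  have hprod : AEStronglyMeasurable (fun q : ℝ × ℝ => k q.2 * l (q.1 - q.2))
      (volume.prod volume) :=
    hk.aestronglyMeasurable.comp_snd.mul (hl.aestronglyMeasurable.comp_quasiMeasurePreserving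
      (quasiMeasurePreserving_sub_of_right_invariant volume volume))
  have hint : Integrable (fun q : ℝ × ℝ => (k q.2 * l (q.1 - q.2)) • T q.1 (u (t - q.1)))
      (volume.prod volume) := by
    refine (integrable_prod_iff (hprod.smul hmt.comp_fst)).2 ⟨?_, ?_⟩
    · filter_upwards [(hk.integrable_conv hl).prod_right_ae] with ρ hρ
      exact Integrable.smul_const (f := fun τ => k τ * l (ρ - τ))
        ((integrable_const_mul_iff (Real.exp_pos _).ne'.isUnit _).1 hρ) (T ρ (u (t - ρ)))
    · refine ht.norm.congr (Filter.Eventually.of_forall fun ρ => ?_)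
      simp only [Pi.smul_apply', norm_smul, norm_mul, Real.norm_eq_abs]
      rw [integral_mul_const, abs_of_nonneg]
      exact integral_nonneg fun τ => by positivity
  calc kernelConv T k (kernelConv T l u) t
      = ∫ τ, ∫ ρ, (k τ * l (ρ - τ)) • T ρ (u (t - ρ)) := by
        refine integral_congr_ae ?_
        filter_upwards [ae_comp_sub_left (hT.ae_integrable hl hu) t] with τ hτ
        rcases le_or_gt τ 0 with h0 | h0
        · simp [hk.1 τ h0]
        rw [kernelConv, ← ContinuousLinearMap.integral_comp_comm _ hτ, ← integral_smul,
          ← integral_sub_right_eq_self _ τ]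
        refine integral_congr_ae (Filter.Eventually.of_forall fun ρ => ?_)
        simp only [map_smul, smul_smul]
        rcases le_or_gt ρ τ with h1 | h1
        · simp [hl.1 (ρ - τ) (by linarith)]
        · have := hT.add τ (ρ - τ) h0 (by linarith)
          rw [add_sub_cancel] at this
          rw [this, ContinuousLinearMap.comp_apply, sub_sub_sub_cancel_right]
    _ = ∫ ρ, ∫ τ, (k τ * l (ρ - τ)) • T ρ (u (t - ρ)) := (integral_integral_swap hint).symm
    _ = _ := by
        refine integral_congr_ae (Filter.Eventually.of_forall fun ρ => ?_)
        exact integral_smul_const _ _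

end Decay

/-! ### Riemann–Liouville kernels and the Beta integral -/

section GammaKernel

/-- The Riemann-Liouville kernel `τ ↦ τ^{a-1} / Γ(a)` on `(0, ∞)`, extended by zero. -/
def gammaKernel (a τ : ℝ) : ℝ := if 0 < τ then τ ^ (a - 1) / Real.Gamma a else 0

theorem gammaKernel_of_pos {a τ : ℝ} (hτ : 0 < τ) :
    gammaKernel a τ = τ ^ (a - 1) / Real.Gamma a := if_pos hτ

theorem gammaKernel_of_nonpos {a τ : ℝ} (hτ : τ ≤ 0) : gammaKernel a τ = 0 := if_neg hτ.not_gt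

theorem gammaKernel_one_of_pos {τ : ℝ} (hτ : 0 < τ) : gammaKernel 1 τ = 1 := by
  simp [gammaKernel_of_pos hτ]

theorem isKernel_gammaKernel {δ a : ℝ} (hδ : 0 < δ) (ha : 0 < a) :
    IsKernel δ (gammaKernel a) := by
  refine ⟨fun τ hτ => gammaKernel_of_nonpos hτ, ?_⟩
  have h : IntegrableOn (fun τ : ℝ => τ ^ (a - 1) * Real.exp (-δ * τ ^ (1 : ℝ))) (Ioi 0) :=
    integrableOn_rpow_mul_exp_neg_mul_rpow (by linarith) one_pos hδ
  refine ((IntegrableOn.integrable_indicator (h.div_const (Real.Gamma a)) measurableSet_Ioi)).congr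
    (Filter.Eventually.of_forall fun τ => ?_)
  rcases le_or_gt τ 0 with h0 | h0
  · simp [gammaKernel_of_nonpos h0, h0.not_gt]
  · simp only [indicator_of_mem (mem_Ioi.2 h0), gammaKernel_of_pos h0, Real.rpow_one]
    ring

theorem integral_rpow_mul_rpow_sub {a b ρ : ℝ} (ha : 0 < a) (hb : 0 < b) (hρ : 0 < ρ) :
    ∫ τ in (0 : ℝ)..ρ, τ ^ (a - 1) * (ρ - τ) ^ (b - 1) =
      ρ ^ (a + b - 1) * (Real.Gamma a * Real.Gamma b / Real.Gamma (a + b)) := by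
  have h1 := Complex.betaIntegral_scaled (a : ℂ) (b : ℂ) hρ
  have h2 := Complex.Gamma_mul_Gamma_eq_betaIntegral (s := a) (t := b) (by simpa) (by simpa)
  have h3 : Complex.Gamma ((a : ℂ) + b) ≠ 0 :=
    Complex.Gamma_ne_zero_of_re_pos (by simpa using add_pos ha hb)
  have h4 : (a : ℂ).betaIntegral b =
      Complex.Gamma a * Complex.Gamma b / Complex.Gamma ((a : ℂ) + b) := by
    rw [h2, mul_div_cancel_left₀ _ h3]
  apply Complex.ofReal_injective
  rw [← intervalIntegral.integral_ofReal]
  push_cast [Complex.ofReal_cpow hρ.le, ← Complex.Gamma_ofReal]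
  rw [← h4, ← h1]
  refine intervalIntegral.integral_congr fun τ hτ => ?_
  rw [uIcc_of_le hρ.le] at hτ
  rw [Complex.ofReal_cpow hτ.1, Complex.ofReal_cpow (sub_nonneg.2 hτ.2)]
  push_cast
  rfl

theorem gammaKernel_conv {a b : ℝ} (ha : 0 < a) (hb : 0 < b) :
    (fun ρ => ∫ τ, gammaKernel a τ * gammaKernel b (ρ - τ)) = gammaKernel (a + b) := by
  funext ρ
  rcases le_or_gt ρ 0 with h0 | h0
  · rw [gammaKernel_of_nonpos h0]
    refine integral_eq_zero_of_ae (Filter.Eventually.of_forall fun τ => ?_)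
    rcases le_or_gt τ 0 with h | h
    · simp [gammaKernel_of_nonpos h]
    · simp [gammaKernel_of_nonpos (show ρ - τ ≤ 0 by linarith)]
  have hΓa := (Real.Gamma_pos_of_pos ha).ne'
  have hΓb := (Real.Gamma_pos_of_pos hb).ne'
  calc ∫ τ, gammaKernel a τ * gammaKernel b (ρ - τ)
      = ∫ τ, (Ioo 0 ρ).indicator (fun τ => τ ^ (a - 1) * (ρ - τ) ^ (b - 1) /
          (Real.Gamma a * Real.Gamma b)) τ := by
        refine integral_congr_ae (Filter.Eventually.of_forall fun τ => ?_)
        simp only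
        by_cases h : τ ∈ Ioo 0 ρ
        · rw [indicator_of_mem h, gammaKernel_of_pos h.1, gammaKernel_of_pos (sub_pos.2 h.2)]
          field_simp
        · rw [indicator_of_notMem h]
          rcases le_or_gt τ 0 with h1 | h1
          · simp [gammaKernel_of_nonpos h1]
          · have : ρ ≤ τ := not_lt.1 fun h2 => h ⟨h1, h2⟩
            simp [gammaKernel_of_nonpos (show ρ - τ ≤ 0 by linarith)]
    _ = (∫ τ in (0 : ℝ)..ρ, τ ^ (a - 1) * (ρ - τ) ^ (b - 1)) /
          (Real.Gamma a * Real.Gamma b) := by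
        rw [integral_indicator measurableSet_Ioo, ← integral_Ioc_eq_integral_Ioo, integral_div,
          intervalIntegral.integral_of_le h0.le]
    _ = gammaKernel (a + b) ρ := by
        rw [integral_rpow_mul_rpow_sub ha hb h0, gammaKernel_of_pos h0]
        field_simp

end GammaKernel

/-! ### Exchanging null sets and vanishing tails -/

section AlmostEverywhere

variable {E : Type*} [NormedAddCommGroup E]

theorem ae_prod_eq_zero_of_ae_ae {f : ℝ × ℝ → E} (hf : AEStronglyMeasurable f (volume.prod volume))
    (h : ∀ᵐ x : ℝ, ∀ᵐ y : ℝ, f (x, y) = 0) : ∀ᵐ q ∂(volume.prod volume), f q = 0 := by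
  have h1 : ∫⁻ q, ‖f q‖ₑ ∂((volume : Measure ℝ).prod (volume : Measure ℝ)) = 0 := by
    rw [lintegral_prod _ hf.enorm, lintegral_eq_zero_of_ae_eq_zero]
    filter_upwards [h] with x hx
    refine lintegral_eq_zero_of_ae_eq_zero ?_
    filter_upwards [hx] with y hy
    simp [hy]
  filter_upwards [(lintegral_eq_zero_iff' hf.enorm).1 h1] with q hq
  simpa using hq

theorem ae_ae_eq_zero_swap {f : ℝ × ℝ → E} (hf : AEStronglyMeasurable f (volume.prod volume))
    (h : ∀ᵐ y : ℝ, ∀ᵐ x : ℝ, f (x, y) = 0) : ∀ᵐ x : ℝ, ∀ᵐ y : ℝ, f (x, y) = 0 := by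
  have h1 := ae_prod_eq_zero_of_ae_ae hf.prod_swap h
  have h2 := (Measure.measurePreserving_swap (μ := (volume : Measure ℝ))
    (ν := (volume : Measure ℝ))).quasiMeasurePreserving.ae h1
  exact Measure.ae_ae_of_ae_prod h2

/-- The primitive of `q` is continuous and vanishes at positive rationals, hence on `(0, ∞)`;
Lebesgue differentiation finishes. Rational endpoints keep the exceptional sets countable in number
when `q` depends on a parameter. -/
theorem ae_eq_zero_of_forall_rat_setIntegral_Ioi [NormedSpace ℝ E] [CompleteSpace E] {q : ℝ → E}
    (hq : Integrable q) (h : ∀ r : ℚ, 0 < r → ∫ τ in Ioi (r : ℝ), q τ = 0) :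
    ∀ᵐ τ : ℝ, 0 < τ → q τ = 0 := by
  have hcont : Continuous fun x => ∫ τ in (1 : ℝ)..x, q τ :=
    intervalIntegral.continuous_primitive (fun _ _ => hq.intervalIntegrable) 1
  have hzero : ∀ x : ℝ, 0 < x → ∫ τ in (1 : ℝ)..x, q τ = 0 := by
    intro x hx
    have hcl : IsClosed {x : ℝ | ∫ τ in (1 : ℝ)..x, q τ = 0} :=
      isClosed_eq hcont continuous_const
    have hd : Dense (range ((↑) : ℚ → ℝ)) := Rat.denseRange_cast
    have hsub : Ioi (0 : ℝ) ∩ range ((↑) : ℚ → ℝ) ⊆ {x : ℝ | ∫ τ in (1 : ℝ)..x, q τ = 0} := by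
      rintro _ ⟨hy, r, rfl⟩
      have h1 := intervalIntegral.integral_Ioi_sub_Ioi' (μ := volume) (f := q) (a := 1)
        (b := (r : ℝ)) hq.integrableOn hq.integrableOn
      have h2 := h 1 one_pos
      rw [Rat.cast_one] at h2
      rw [mem_ofPred_eq, ← h1, h2, h r (Rat.cast_pos.1 (mem_Ioi.1 hy)), sub_zero]
    exact hcl.closure_subset_iff.2 hsub (hd.open_subset_closure_inter isOpen_Ioi hx)
  filter_upwards [LocallyIntegrable.ae_hasDerivAt_integral hq.locallyIntegrable] with x hx h0
  have h1 : HasDerivAt (fun _ : ℝ => (0 : E)) (q x) x := by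
    refine (hx 1).congr_of_eventuallyEq ?_
    filter_upwards [lt_mem_nhds h0] with y hy
    exact (hzero y hy).symm
  exact h1.unique (hasDerivAt_const x 0)

end AlmostEverywhere

/-! ### Increments as integrals of the weak derivative -/

section WeakDerivative

variable {E : Type*} [NormedAddCommGroup E] [NormedSpace ℝ E]

theorem WeightedIntegrable.locallyIntegrable {δ : ℝ} {u : ℝ → E} (hu : WeightedIntegrable δ u) :
    LocallyIntegrable u volume := by
  rw [locallyIntegrable_iff]
  intro K hK
  have h : IntegrableOn (fun t => Real.exp (δ * |t|) • Real.exp (-δ * |t|) • u t) K :=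
    (Integrable.integrableOn hu).continuousOn_smul (by fun_prop) hK
  refine h.congr (Filter.Eventually.of_forall fun t => ?_)
  simp only [smul_smul, ← Real.exp_add]
  simp

theorem WeightedIntegrable.intervalIntegrable {δ : ℝ} {u : ℝ → E} (hu : WeightedIntegrable δ u)
    (a b : ℝ) : IntervalIntegrable u volume a b :=
  intervalIntegrable_iff.2 ((hu.locallyIntegrable.integrableOn_isCompact isCompact_uIcc).mono_set
    uIoc_subset_uIcc)

theorem WeightedIntegrable.comp_sub_right {δ : ℝ} (hδ : 0 ≤ δ) {u : ℝ → E}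
    (hu : WeightedIntegrable δ u) (h : ℝ) : WeightedIntegrable δ (fun t => u (t - h)) := by
  refine ((Integrable.comp_sub_right hu h).norm.const_mul (Real.exp (δ * |h|))).mono'
    (AEStronglyMeasurable.smul (by fun_prop) (hu.aestronglyMeasurable.comp_quasiMeasurePreserving
      (measurePreserving_sub_right volume h).quasiMeasurePreserving))
    (Filter.Eventually.of_forall fun t => ?_)
  simp only [norm_smul, Real.norm_of_nonneg (Real.exp_pos _).le, ← mul_assoc, ← Real.exp_add]
  gcongr
  have := abs_sub t h
  nlinarith

theorem WeightedIntegrable.integrable_comp_add_smul {δ : ℝ} (hδ : 0 ≤ δ) {u : ℝ → E}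
    (hu : WeightedIntegrable δ u) {φ : ℝ → ℝ} (hφ : Continuous φ) (hc : HasCompactSupport φ)
    (h : ℝ) : Integrable (fun q : ℝ × ℝ => φ (q.1 + q.2) • u q.1)
      (volume.prod (volume.restrict (Ioc 0 h))) := by
  obtain ⟨C, hC⟩ : ∃ C, ∀ x, ‖Real.exp (δ * |x|) * φ x‖ ≤ C :=
    HasCompactSupport.exists_bound_of_continuous hc.mul_left (by fun_prop)
  have h1 : Integrable (fun τ => C * Real.exp (δ * τ)) (volume.restrict (Ioc 0 h)) :=
    (Continuous.integrableOn_Ioc (by fun_prop))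
  refine (Integrable.mul_prod (Integrable.norm hu) h1).mono'
    (AEStronglyMeasurable.smul (by fun_prop) hu.aestronglyMeasurable.comp_fst) ?_
  have h2 : ∀ᵐ q ∂((volume : Measure ℝ).prod (volume.restrict (Ioc 0 h))), q.2 ∈ Ioc 0 h :=
    Measure.quasiMeasurePreserving_snd.ae (ae_restrict_mem measurableSet_Ioc)
  filter_upwards [h2] with q hq
  have h3 := hC (q.1 + q.2)
  rw [norm_mul, Real.norm_of_nonneg (Real.exp_pos _).le] at h3
  have h4 : 1 ≤ Real.exp (-δ * |q.1|) * Real.exp (δ * q.2) * Real.exp (δ * |q.1 + q.2|) := by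
    rw [← Real.exp_add, ← Real.exp_add]
    refine Real.one_le_exp ?_
    have : |q.1| ≤ |q.1 + q.2| + q.2 := by
      simpa [abs_of_pos hq.1] using abs_sub (q.1 + q.2) q.2
    nlinarith
  simp only [norm_smul, Real.norm_of_nonneg (Real.exp_pos _).le]
  calc ‖φ (q.1 + q.2)‖ * ‖u q.1‖ ≤ (Real.exp (-δ * |q.1|) * Real.exp (δ * q.2) *
          Real.exp (δ * |q.1 + q.2|)) * (‖φ (q.1 + q.2)‖ * ‖u q.1‖) :=
        le_mul_of_one_le_left (by positivity) h4
    _ = (Real.exp (-δ * |q.1|) * Real.exp (δ * q.2) * ‖u q.1‖) *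
          (Real.exp (δ * |q.1 + q.2|) * ‖φ (q.1 + q.2)‖) := by ring
    _ ≤ (Real.exp (-δ * |q.1|) * Real.exp (δ * q.2) * ‖u q.1‖) * C := by gcongr
    _ = _ := by ring

/-- Tested against `φ`, the increment becomes `-∫₀ʰ ∫ φ'(t + τ) v(t) dt dτ`, and the weak derivative
is then applied to each translate of `φ`. -/
theorem WeightedIntegrable.ae_sub_eq_integral [CompleteSpace E] {δ : ℝ} (hδ : 0 ≤ δ) {v v' : ℝ → E}
    (hv : WeightedIntegrable δ v) (hv' : WeightedIntegrable δ v')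
    (hd : ∀ φ : ℝ → ℝ, ContDiff ℝ ∞ φ → HasCompactSupport φ →
      ∫ t, deriv φ t • v t = - ∫ t, φ t • v' t) {h : ℝ} (hh : 0 < h) :
    ∀ᵐ t : ℝ, v t - v (t - h) = ∫ τ in (0 : ℝ)..h, v' (t - τ) := by
  have hvl := hv.locallyIntegrable
  have hvh := (hv.comp_sub_right hδ h).locallyIntegrable
  have hii : ∀ a b : ℝ, IntervalIntegrable v' volume a b := hv'.intervalIntegrable
  have hprim : ∀ t, ∫ τ in (0 : ℝ)..h, v' (t - τ) =
      (∫ τ in (0 : ℝ)..t, v' τ) - ∫ τ in (0 : ℝ)..(t - h), v' τ := by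
    intro t
    rw [intervalIntegral.integral_comp_sub_left, sub_zero,
      intervalIntegral.integral_interval_sub_left (hii _ _) (hii _ _)]
  have hpc : Continuous fun t => ∫ τ in (0 : ℝ)..t, v' τ :=
    intervalIntegral.continuous_primitive hii 0
  have hcont : Continuous fun t => ∫ τ in (0 : ℝ)..h, v' (t - τ) := by
    simp only [hprim]
    exact hpc.sub (hpc.comp (by fun_prop))
  refine ae_eq_of_integral_contDiff_smul_eq (hvl.sub hvh) hcont.locallyIntegrable
    fun φ hφ hc => ?_
  have hshift : ∀ ψ : ℝ → ℝ, HasCompactSupport ψ → ∀ τ : ℝ,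
      HasCompactSupport fun t => ψ (t + τ) := fun ψ hψ τ =>
    hψ.comp_homeomorph (Homeomorph.addRight τ)
  have hφ' : Continuous (deriv φ) := hφ.continuous_deriv (by simp)
  have hint' := hv'.integrable_comp_add_smul hδ hφ.continuous hc h
  have hint := hv.integrable_comp_add_smul hδ hφ' hc.deriv h
  have hint'' : Integrable (fun q : ℝ × ℝ => φ q.1 • v' (q.1 - q.2))
      (volume.prod (volume.restrict (Ioc 0 h))) := by
    refine ((measurePreserving_sub_prod volume (volume.restrict (Ioc 0 h))).integrable_comp
      hint'.1).2 hint' |>.congr (Filter.Eventually.of_forall fun q => ?_)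
    simp
  have hi1 : Integrable (fun t => φ t • v t) :=
    hvl.integrable_smul_left_of_hasCompactSupport hφ.continuous hc
  have hi2 : Integrable (fun t => φ t • v (t - h)) :=
    hvh.integrable_smul_left_of_hasCompactSupport hφ.continuous hc
  have hi3 : Integrable (fun t => φ (t + h) • v t) :=
    hvl.integrable_smul_left_of_hasCompactSupport (hφ.continuous.comp (by fun_prop))
      (hshift φ hc h)
  calc ∫ t, φ t • (v - fun t => v (t - h)) t
      = (∫ t, φ t • v t) - ∫ t, φ t • v (t - h) := by
        rw [← integral_sub hi1 hi2]
        simp [smul_sub]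
    _ = (∫ t, φ t • v t) - ∫ t, φ (t + h) • v t := by
        rw [← integral_add_right_eq_self (fun t => φ t • v (t - h)) h]
        simp
    _ = -∫ t, (∫ τ in Ioc 0 h, deriv φ (t + τ) • v t) := by
        rw [← integral_sub hi1 hi3, ← integral_neg]
        refine integral_congr_ae (Filter.Eventually.of_forall fun t => ?_)
        simp only
        rw [integral_smul_const, ← intervalIntegral.integral_of_le hh.le,
          intervalIntegral.integral_comp_add_left, intervalIntegral.integral_deriv_eq_sub
            (fun x _ => (hφ.differentiable (by simp)).differentiableAt)
            (hφ'.intervalIntegrable _ _),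
          ← neg_smul, ← sub_smul]
        simp
    _ = -∫ τ in Ioc 0 h, ∫ t, deriv φ (t + τ) • v t := by
        rw [integral_integral_swap hint]
    _ = ∫ τ in Ioc 0 h, ∫ t, φ t • v' (t - τ) := by
        rw [← integral_neg]
        refine integral_congr_ae (Filter.Eventually.of_forall fun τ => ?_)
        simp only
        have := hd (fun t => φ (t + τ)) (hφ.comp (by fun_prop)) (hshift φ hc τ)
        simp only [deriv_comp_add_const] at this
        rw [this, neg_neg, ← integral_add_right_eq_self (fun t => φ t • v' (t - τ)) τ]
        simp
    _ = ∫ t, ∫ τ in Ioc 0 h, φ t • v' (t - τ) := (integral_integral_swap hint'').symm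
    _ = ∫ t, φ t • ∫ τ in (0 : ℝ)..h, v' (t - τ) := by
        refine integral_congr_ae (Filter.Eventually.of_forall fun t => ?_)
        simp only
        rw [integral_smul, intervalIntegral.integral_of_le hh.le]

/-- The exceptional set of times depends on `h`; joint measurability of `w(t) - w(t - h)`, with `w`
equal to `v` minus a primitive of `v'`, lets Fubini exchange the quantifiers. -/
theorem WeightedIntegrable.ae_ae_sub_eq_integral [CompleteSpace E] {δ : ℝ} (hδ : 0 ≤ δ)
    {v v' : ℝ → E} (hv : WeightedIntegrable δ v) (hv' : WeightedIntegrable δ v')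
    (hd : ∀ φ : ℝ → ℝ, ContDiff ℝ ∞ φ → HasCompactSupport φ →
      ∫ t, deriv φ t • v t = - ∫ t, φ t • v' t) :
    ∀ᵐ t : ℝ, ∀ᵐ h : ℝ, 0 < h → v t - v (t - h) = ∫ τ in (0 : ℝ)..h, v' (t - τ) := by
  have hii : ∀ a b : ℝ, IntervalIntegrable v' volume a b := hv'.intervalIntegrable
  have hpc : Continuous fun t => ∫ τ in (0 : ℝ)..t, v' τ :=
    intervalIntegral.continuous_primitive hii 0
  set w : ℝ → E := fun t => v t - ∫ τ in (0 : ℝ)..t, v' τ with hw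
  have hwm : AEStronglyMeasurable w volume :=
    hv.aestronglyMeasurable.sub hpc.aestronglyMeasurable
  have hwi : ∀ t h : ℝ, v t - v (t - h) = ∫ τ in (0 : ℝ)..h, v' (t - τ) ↔ w t - w (t - h) = 0 := by
    intro t h
    rw [intervalIntegral.integral_comp_sub_left, sub_zero,
      ← intervalIntegral.integral_interval_sub_left (hii 0 _) (hii 0 _), ← sub_eq_zero, hw]
    refine Eq.congr ?_ rfl
    simp only
    abel
  have hm : AEStronglyMeasurable (fun q : ℝ × ℝ => (Ioi (0 : ℝ)).indicator (fun _ => (1 : ℝ)) q.2 •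
      (w q.1 - w (q.1 - q.2))) (volume.prod volume) := by
    refine AEStronglyMeasurable.smul ?_ (hwm.comp_fst.sub (hwm.comp_quasiMeasurePreserving
      (quasiMeasurePreserving_sub_of_right_invariant volume volume)))
    exact ((measurable_const.indicator measurableSet_Ioi).comp measurable_snd).aestronglyMeasurable
  have := ae_ae_eq_zero_swap hm (Filter.Eventually.of_forall fun h => by
    rcases le_or_gt h 0 with h0 | h0
    · simp [h0.not_gt]
    · filter_upwards [hv.ae_sub_eq_integral hδ hv' hd h0] with t ht
      rw [(hwi t h).1 ht, smul_zero])
  filter_upwards [this] with t ht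
  filter_upwards [ht] with h hh h0
  rw [indicator_of_mem (mem_Ioi.2 h0), one_smul] at hh
  exact (hwi t h).2 hh

end WeakDerivative

/-! ### The operator `J`, inversion of `∂_t + A`, and resolvent identities -/

section Inverse

variable {X : Type*} [NormedAddCommGroup X] [NormedSpace ℝ X]
variable {T : ℝ → X →L[ℝ] X} {M δ : ℝ}

theorem IsDecaySemigroup.kernelConv_gammaKernel_one (hT : IsDecaySemigroup T M δ) (u : ℝ → X)
    (t : ℝ) : kernelConv T (gammaKernel 1) u t = ∫ τ, T τ (u (t - τ)) := by
  refine integral_congr_ae (Filter.Eventually.of_forall fun τ => ?_)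
  rcases le_or_gt τ 0 with h | h
  · simp [hT.zero τ h]
  · simp [gammaKernel_one_of_pos h]

theorem IsDecaySemigroup.ae_integrable_one (hT : IsDecaySemigroup T M δ) {u : ℝ → X}
    (hu : WeightedIntegrable δ u) : ∀ᵐ t : ℝ, Integrable (fun τ => T τ (u (t - τ))) := by
  filter_upwards [hT.ae_integrable (isKernel_gammaKernel hT.pos one_pos) hu] with t ht
  refine ht.congr (Filter.Eventually.of_forall fun τ => ?_)
  rcases le_or_gt τ 0 with h | h
  · simp [hT.zero τ h]
  · simp [gammaKernel_one_of_pos h]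

theorem IsDecaySemigroup.integrable_apply (hT : IsDecaySemigroup T M δ) (x : X) :
    Integrable (fun τ => T τ x) :=
  (hT.ae_integrable_one (weightedIntegrable_const hT.pos x)).exists.choose_spec

theorem IsDecaySemigroup.integrable_bound (hT : IsDecaySemigroup T M δ) :
    Integrable ((Ioi (0 : ℝ)).indicator fun τ => M * Real.exp (-(2 * δ) * τ)) := by
  have h : IntegrableOn (fun t : ℝ => Real.exp (-(2 * δ) * t)) (Ioi 0) :=
    integrableOn_exp_mul_Ioi (by linarith [hT.pos]) 0
  exact IntegrableOn.integrable_indicator (h.const_mul M) measurableSet_Ioi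

/-- The operator `x ↦ ∫ T(τ) x dτ`, the inverse of the negative generator. -/
def IsDecaySemigroup.integralOp (hT : IsDecaySemigroup T M δ) : X →L[ℝ] X :=
  LinearMap.mkContinuous
    { toFun := fun x => ∫ τ, T τ x
      map_add' := fun x y => by
        simp only [map_add]
        exact integral_add (hT.integrable_apply x) (hT.integrable_apply y)
      map_smul' := fun c x => by
        simp only [map_smul]
        exact integral_smul _ _ }
    (∫ τ, (Ioi (0 : ℝ)).indicator (fun τ => M * Real.exp (-(2 * δ) * τ)) τ)
    fun x => by
      rw [← integral_mul_const]
      refine norm_integral_le_of_norm_le (hT.integrable_bound.mul_const _)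
        (Filter.Eventually.of_forall fun τ => ?_)
      rcases le_or_gt τ 0 with h | h
      · simp [hT.zero τ h, h.not_gt]
      · rw [indicator_of_mem (mem_Ioi.2 h)]
        exact hT.norm_apply_le τ x

theorem IsDecaySemigroup.integralOp_apply (hT : IsDecaySemigroup T M δ) (x : X) :
    hT.integralOp x = ∫ τ, T τ x := rfl

/-- Applying `T(h)` shifts the semigroup variable and cuts the integral down to its tail; this
serves both single orbits and convolutions. -/
theorem IsDecaySemigroup.apply_integral_comp [CompleteSpace X]
    (hT : IsDecaySemigroup T M δ) {h : ℝ} (hh : 0 < h)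
    {q : ℝ → X} (hq : Integrable fun τ => T τ (q (h + τ))) :
    T h (∫ τ, T τ (q (h + τ))) = ∫ σ in Ioi h, T σ (q σ) := by
  rw [← ContinuousLinearMap.integral_comp_comm _ hq, ← integral_indicator measurableSet_Ioi,
    ← integral_add_left_eq_self ((Ioi h).indicator fun σ => T σ (q σ)) h]
  refine integral_congr_ae (Filter.Eventually.of_forall fun τ => ?_)
  rcases le_or_gt τ 0 with h0 | h0
  · simp [hT.zero τ h0, h0.not_gt]
  · simp [h0, hT.add h τ hh h0]

theorem IsDecaySemigroup.apply_integralOp [CompleteSpace X]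
    (hT : IsDecaySemigroup T M δ) {h : ℝ} (hh : 0 < h)
    (x : X) : T h (hT.integralOp x) = ∫ σ in Ioi h, T σ x :=
  hT.apply_integral_comp hh (q := fun _ => x) (hT.integrable_apply x)

theorem IsDecaySemigroup.integralOp_comm [CompleteSpace X]
    (hT : IsDecaySemigroup T M δ) (h : ℝ) (x : X) :
    hT.integralOp (T h x) = T h (hT.integralOp x) := by
  rcases le_or_gt h 0 with h0 | h0
  · simp [hT.zero h h0]
  rw [integralOp_apply, integralOp_apply,
    ← ContinuousLinearMap.integral_comp_comm _ (hT.integrable_apply x)]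
  refine integral_congr_ae (Filter.Eventually.of_forall fun τ => ?_)
  rcases le_or_gt τ 0 with h1 | h1
  · simp [hT.zero τ h1]
  · simp only [← ContinuousLinearMap.comp_apply, ← hT.add _ _ h1 h0, ← hT.add _ _ h0 h1, add_comm]

/-- Convolution with the semigroup is injective. -/
theorem IsDecaySemigroup.ae_eq_zero_of_kernelConv_one [CompleteSpace X]
    (hT : IsDecaySemigroup T M δ)
    (hinj : ∀ x, hT.integralOp x = 0 → x = 0) {g : ℝ → X} (hg : WeightedIntegrable δ g)
    (h : kernelConv T (gammaKernel 1) g =ᵐ[volume] 0) : g =ᵐ[volume] 0 := by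
  have hint := hT.ae_integrable_one hg
  have htail : ∀ᵐ t : ℝ, ∀ r : ℚ, 0 < r → ∫ τ in Ioi (r : ℝ), T τ (g (t - τ)) = 0 := by
    refine ae_all_iff.2 fun r => ?_
    have hmp := (measurePreserving_sub_right (volume : Measure ℝ) (r : ℝ)).quasiMeasurePreserving
    -- The vanishing convolution is evaluated at `t - r`, so that `T(r)` reproduces the tail beyond
    -- `r` at time `t`.
    filter_upwards [hmp.ae h, hmp.ae hint] with t ht hti hr
    have hi : Integrable fun τ => T τ (g (t - (r + τ))) := by
      simpa only [sub_sub] using hti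
    rw [← hT.apply_integral_comp (q := fun σ => g (t - σ)) (Rat.cast_pos.2 hr) hi]
    rw [hT.kernelConv_gammaKernel_one] at ht
    simp only [sub_sub, Pi.zero_apply] at ht
    rw [ht, map_zero]
  have hae : ∀ᵐ t : ℝ, ∀ᵐ τ : ℝ, T τ (g (t - τ)) = 0 := by
    filter_upwards [htail, hint] with t ht hti
    filter_upwards [ae_eq_zero_of_forall_rat_setIntegral_Ioi hti ht] with τ hτ
    rcases le_or_gt τ 0 with h0 | h0
    · simp [hT.zero τ h0]
    · exact hτ h0
  have hprod := ae_prod_eq_zero_of_ae_ae (hT.aestronglyMeasurable_shear hg.aestronglyMeasurable) hae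
  -- The shear `t = r + τ` freezes the argument of `g` at `r`, leaving the orbit `τ ↦ T(τ) g(r)` to
  -- integrate.
  have hprod' := (measurePreserving_add_prod (volume : Measure ℝ)
    (volume : Measure ℝ)).quasiMeasurePreserving.ae hprod
  filter_upwards [Measure.ae_ae_of_ae_prod hprod'] with r hr
  refine hinj _ (integral_eq_zero_of_ae ?_)
  filter_upwards [hr] with τ hτ
  simpa using hτ

/-- Variation of constants: convolution with the semigroup inverts `∂_t + A`. -/
theorem IsDecaySemigroup.kernelConv_one_add_of_weakDeriv [CompleteSpace X]
    (hT : IsDecaySemigroup T M δ)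
    (hinj : ∀ x, hT.integralOp x = 0 → x = 0) {v v' g : ℝ → X} (hv : WeightedIntegrable δ v)
    (hv' : WeightedIntegrable δ v') (hg : WeightedIntegrable δ g)
    (hd : ∀ φ : ℝ → ℝ, ContDiff ℝ ∞ φ → HasCompactSupport φ →
      ∫ t, deriv φ t • v t = - ∫ t, φ t • v' t)
    (hvg : ∀ᵐ t, v t = hT.integralOp (g t)) :
    kernelConv T (gammaKernel 1) (fun t => v' t + g t) =ᵐ[volume] v := by
  filter_upwards [hT.ae_integrable_one hv', hT.ae_integrable_one hg, hT.ae_integrable_one hv,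
    hv.ae_ae_sub_eq_integral hT.pos.le hv' hd] with t hi' hig hi hdt
  -- On `0 < τ < σ` one has `|t - τ| ≤ |t| + σ`, so half of `e^{-2δσ}` absorbs the weight of `v'`
  -- and the other half gives integrability in `σ`.
  have hF : Integrable (fun q : ℝ × ℝ => {q : ℝ × ℝ | 0 < q.1 ∧ q.1 < q.2}.indicator
      (fun q => T q.2 (v' (t - q.1))) q) (volume.prod volume) := by
    have hm : AEStronglyMeasurable (fun q : ℝ × ℝ => T q.2 (v' (t - q.1)))
        (volume.prod volume) :=
      hT.aestronglyMeasurable_prod (hv'.aestronglyMeasurable.comp_quasiMeasurePreserving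
        (quasiMeasurePreserving_sub_left volume t))
    have hset : MeasurableSet {q : ℝ × ℝ | 0 < q.1 ∧ q.1 < q.2} :=
      (measurableSet_lt measurable_const measurable_fst).inter
        (measurableSet_lt measurable_fst measurable_snd)
    have h1 : Integrable (fun τ => Real.exp (-δ * |t - τ|) • v' (t - τ)) :=
      Integrable.comp_sub_left hv' t
    have h2 : IntegrableOn (fun σ : ℝ => Real.exp (-δ * σ)) (Ioi 0) :=
      integrableOn_exp_mul_Ioi (by linarith [hT.pos]) 0
    refine ((h1.norm.mul_prod (h2.integrable_indicator measurableSet_Ioi)).const_mul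
      (M * Real.exp (δ * |t|))).mono' (hm.indicator hset) (Filter.Eventually.of_forall fun q => ?_)
    have hM := hT.nonneg
    by_cases hq : q ∈ {q : ℝ × ℝ | 0 < q.1 ∧ q.1 < q.2}
    · have hq2 : q.2 ∈ Ioi (0 : ℝ) := hq.1.trans hq.2
      rw [indicator_of_mem hq, indicator_of_mem hq2, norm_smul,
        Real.norm_of_nonneg (Real.exp_pos _).le]
      refine (hT.norm_apply_le _ _).trans ?_
      have h3 : Real.exp (-(2 * δ) * q.2) ≤
          Real.exp (δ * |t|) * (Real.exp (-δ * |t - q.1|) * Real.exp (-δ * q.2)) := by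
        rw [← Real.exp_add, ← Real.exp_add]
        refine Real.exp_le_exp.2 ?_
        have h4 : |t - q.1| ≤ |t| + q.1 := by simpa [abs_of_pos hq.1] using abs_sub t q.1
        have h5 := hq.2
        nlinarith [hT.pos]
      calc M * Real.exp (-(2 * δ) * q.2) * ‖v' (t - q.1)‖
          ≤ M * (Real.exp (δ * |t|) * (Real.exp (-δ * |t - q.1|) * Real.exp (-δ * q.2))) *
            ‖v' (t - q.1)‖ := by gcongr
        _ = _ := by ring
    · rw [indicator_of_notMem hq, norm_zero]
      refine mul_nonneg (by positivity) (mul_nonneg (norm_nonneg _) (indicator_nonneg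
        (fun _ _ => (Real.exp_pos _).le) _))
  have hmain : hT.integralOp (∫ τ, T τ (v' (t - τ))) =
      hT.integralOp (v t) - ∫ τ, T τ (v (t - τ)) := by
    calc hT.integralOp (∫ τ, T τ (v' (t - τ)))
        = ∫ τ, hT.integralOp (T τ (v' (t - τ))) :=
          (ContinuousLinearMap.integral_comp_comm _ hi').symm
      _ = ∫ τ, ∫ σ, {q : ℝ × ℝ | 0 < q.1 ∧ q.1 < q.2}.indicator
            (fun q => T q.2 (v' (t - q.1))) (τ, σ) := by
          refine integral_congr_ae (Filter.Eventually.of_forall fun τ => ?_)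
          simp only
          rcases le_or_gt τ 0 with h0 | h0
          · simp [hT.zero τ h0, h0.not_gt, indicator]
          · rw [hT.integralOp_comm, hT.apply_integralOp h0, ← integral_indicator measurableSet_Ioi]
            simp [h0, indicator]
      _ = ∫ σ, ∫ τ, {q : ℝ × ℝ | 0 < q.1 ∧ q.1 < q.2}.indicator
            (fun q => T q.2 (v' (t - q.1))) (τ, σ) := integral_integral_swap hF
      _ = ∫ σ, (T σ (v t) - T σ (v (t - σ))) := by
          refine integral_congr_ae ?_
          filter_upwards [hdt] with σ hσ
          rcases le_or_gt σ 0 with h0 | h0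
          · simp [hT.zero σ h0, indicator]
          · have hiv : IntervalIntegrable (fun τ => v' (t - τ)) volume 0 σ := by
              simpa using (hv'.intervalIntegrable (t - 0) (t - σ)).comp_sub_left t
            rw [← map_sub, hσ h0, intervalIntegral.integral_of_le h0.le,
              ← ContinuousLinearMap.integral_comp_comm _
                ((intervalIntegrable_iff_integrableOn_Ioc_of_le h0.le).1 hiv),
              integral_Ioc_eq_integral_Ioo, ← integral_indicator measurableSet_Ioo]
            simp [indicator]
      _ = _ := integral_sub (hT.integrable_apply _) hi
  -- Because `v = J g` and `J` commutes with `T(τ)`, the term left over in `hmain` cancels the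
  -- contribution of `g`.
  have hvg' : ∫ τ, T τ (v (t - τ)) = hT.integralOp (∫ τ, T τ (g (t - τ))) := by
    rw [← ContinuousLinearMap.integral_comp_comm _ hig]
    refine integral_congr_ae ?_
    filter_upwards [ae_comp_sub_left hvg t] with τ hτ
    rw [hτ, hT.integralOp_comm]
  rw [hT.kernelConv_gammaKernel_one]
  simp only [map_add]
  rw [integral_add hi' hig, ← sub_eq_zero]
  refine hinj _ ?_
  rw [map_sub, map_add, hmain, hvg']
  abel

/-- For a constant function the convolution does not depend on time, so an almost everywhere
identity yields a pointwise one. -/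
theorem IsDecaySemigroup.integral_smul_integral [CompleteSpace X]
    (hT : IsDecaySemigroup T M δ) {k l : ℝ → ℝ}
    (hk : IsKernel δ k) (hl : IsKernel δ l) (x : X) :
    ∫ τ, k τ • T τ (∫ σ, l σ • T σ x) = ∫ ρ, (∫ τ, k τ * l (ρ - τ)) • T ρ x :=
  (hT.kernelConv_kernelConv hk hl (weightedIntegrable_const hT.pos x)).exists.choose_spec

/-- The exponential kernel `τ ↦ e^{-aτ}` on `(0, ∞)`, extended by zero. -/
def expKernel (a τ : ℝ) : ℝ := if 0 < τ then Real.exp (-a * τ) else 0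

theorem isKernel_expKernel {δ a : ℝ} (hδ : 0 < δ) (ha : 0 ≤ a) : IsKernel δ (expKernel a) := by
  refine ⟨fun τ hτ => if_neg hτ.not_gt, ?_⟩
  have h : IntegrableOn (fun t : ℝ => Real.exp (-(δ + a) * t)) (Ioi 0) :=
    integrableOn_exp_mul_Ioi (by linarith) 0
  refine (h.integrable_indicator measurableSet_Ioi).congr
    (Filter.Eventually.of_forall fun τ => ?_)
  by_cases hτ : 0 < τ
  · simp only [indicator_of_mem (mem_Ioi.2 hτ), expKernel, if_pos hτ, ← Real.exp_add]
    ring_nf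
  · simp [hτ, expKernel]

theorem expKernel_conv_gammaKernel_one {a : ℝ} (ha : 0 < a) (ρ : ℝ) :
    ∫ τ, expKernel a τ * gammaKernel 1 (ρ - τ) = a⁻¹ * (gammaKernel 1 ρ - expKernel a ρ) := by
  rcases le_or_gt ρ 0 with h0 | h0
  · rw [gammaKernel_of_nonpos h0, expKernel, if_neg h0.not_gt, sub_zero, mul_zero]
    refine integral_eq_zero_of_ae (Filter.Eventually.of_forall fun τ => ?_)
    by_cases h : 0 < τ
    · simp [gammaKernel_of_nonpos (show ρ - τ ≤ 0 by linarith)]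
    · simp [expKernel, h]
  · calc ∫ τ, expKernel a τ * gammaKernel 1 (ρ - τ)
        = ∫ τ, (Ioo 0 ρ).indicator (fun τ => Real.exp (-a * τ)) τ := by
          refine integral_congr_ae (Filter.Eventually.of_forall fun τ => ?_)
          simp only
          by_cases h : τ ∈ Ioo 0 ρ
          · rw [indicator_of_mem h, expKernel, if_pos h.1, gammaKernel_one_of_pos (sub_pos.2 h.2),
              mul_one]
          · rw [indicator_of_notMem h]
            by_cases h1 : 0 < τ
            · have : ρ ≤ τ := not_lt.1 fun h2 => h ⟨h1, h2⟩
              simp [gammaKernel_of_nonpos (show ρ - τ ≤ 0 by linarith)]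
            · simp [expKernel, h1]
      _ = ∫ τ in (0 : ℝ)..ρ, Real.exp (-a * τ) := by
          rw [integral_indicator measurableSet_Ioo, ← integral_Ioc_eq_integral_Ioo,
            intervalIntegral.integral_of_le h0.le]
      _ = _ := by
          rw [intervalIntegral.integral_comp_mul_left _ (neg_ne_zero.2 ha.ne'), integral_exp,
            gammaKernel_one_of_pos h0, expKernel, if_pos h0]
          simp only [mul_zero, Real.exp_zero, smul_eq_mul]
          field_simp
          ring

theorem IsDecaySemigroup.smul_integral_expKernel_conv (hT : IsDecaySemigroup T M δ) {a : ℝ}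
    (ha : 0 < a) (x : X) :
    ∫ ρ, (∫ τ, expKernel a τ * gammaKernel 1 (ρ - τ)) • T ρ x =
      a⁻¹ • (hT.integralOp x - ∫ τ, expKernel a τ • T τ x) := by
  have hi := (hT.ae_integrable (isKernel_expKernel hT.pos ha.le)
    (weightedIntegrable_const hT.pos x)).exists.choose_spec
  rw [hT.integralOp_apply, ← integral_sub (hT.integrable_apply x) hi, ← integral_smul]
  refine integral_congr_ae (Filter.Eventually.of_forall fun ρ => ?_)
  simp only [expKernel_conv_gammaKernel_one ha, mul_smul, sub_smul]
  rcases le_or_gt ρ 0 with h0 | h0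
  · simp [hT.zero ρ h0]
  · simp [gammaKernel_one_of_pos h0]

theorem IsDecaySemigroup.integralOp_eq_integral (hT : IsDecaySemigroup T M δ) (x : X) :
    hT.integralOp x = ∫ τ, gammaKernel 1 τ • T τ x :=
  (hT.kernelConv_gammaKernel_one (fun _ => x) 0).symm

/-- This is the resolvent identity between `0` and `-a`, coming from `∫₀^ρ e^{-aτ} dτ = (1 -
e^{-aρ}) / a`. -/
theorem IsDecaySemigroup.integral_expKernel_integralOp [CompleteSpace X]
    (hT : IsDecaySemigroup T M δ) {a : ℝ}
    (ha : 0 < a) (x : X) : ∫ τ, expKernel a τ • T τ (hT.integralOp x) =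
      a⁻¹ • (hT.integralOp x - ∫ τ, expKernel a τ • T τ x) := by
  rw [← hT.smul_integral_expKernel_conv ha, hT.integralOp_eq_integral]
  exact hT.integral_smul_integral (isKernel_expKernel hT.pos ha.le)
    (isKernel_gammaKernel hT.pos one_pos) x

theorem IsDecaySemigroup.integralOp_integral_expKernel [CompleteSpace X]
    (hT : IsDecaySemigroup T M δ) {a : ℝ}
    (ha : 0 < a) (x : X) : hT.integralOp (∫ τ, expKernel a τ • T τ x) =
      a⁻¹ • (hT.integralOp x - ∫ τ, expKernel a τ • T τ x) := by
  rw [← hT.smul_integral_expKernel_conv ha, hT.integralOp_eq_integral,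
    hT.integral_smul_integral (isKernel_gammaKernel hT.pos one_pos)
      (isKernel_expKernel hT.pos ha.le) x]
  refine integral_congr_ae (Filter.Eventually.of_forall fun ρ => ?_)
  simp only
  rw [← integral_sub_left_eq_self _ volume ρ]
  simp [mul_comm]

end Inverse

/-! ### Transfer to `S`, the generator, and the fractional integrals -/

section Complex

variable {X : Type*} [NormedAddCommGroup X] [NormedSpace ℂ X]

/-- The real-linear semigroup operators, extended by zero to `τ ≤ 0`. -/
def truncation (S : ℝ → X →L[ℂ] X) (τ : ℝ) : X →L[ℝ] X :=
  if 0 < τ then (S τ).restrictScalars ℝ else 0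

theorem truncation_apply_of_pos (S : ℝ → X →L[ℂ] X) {τ : ℝ} (hτ : 0 < τ) (x : X) :
    truncation S τ x = S τ x := by
  simp [truncation, hτ]

theorem IsMeasurableSemigroup.exists_isDecaySemigroup {S : ℝ → X →L[ℂ] X}
    (hS : IsMeasurableSemigroup S) (hexp : IsExpStable S) :
    ∃ M δ : ℝ, IsDecaySemigroup (truncation S) M δ := by
  obtain ⟨M, w, hM, hw, hb⟩ := hexp
  -- Half the decay rate is taken as the weight, leaving the other half for integrability.
  refine ⟨M, w / 2, half_pos hw, fun τ hτ => if_neg hτ.not_gt, fun τ σ hτ hσ => ?_, fun x => ?_,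
    fun τ => ?_⟩
  · ext x
    simp [truncation, hτ, hσ, add_pos hτ hσ, hS.add τ σ hτ.le hσ.le]
  · have h := ((hS.measurable x).mono_measure (Measure.restrict_mono_set _ Ioi_subset_Ici_self))
    refine ((aestronglyMeasurable_indicator_iff measurableSet_Ioi).2 h).congr
      (Filter.Eventually.of_forall fun τ => ?_)
    by_cases hτ : 0 < τ <;> simp [truncation, hτ]
  · rw [mul_div_cancel₀ _ two_ne_zero]
    by_cases hτ : 0 < τ
    · rw [truncation, if_pos hτ, ContinuousLinearMap.norm_restrictScalars]
      exact hb τ hτ.le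
    · rw [truncation, if_neg hτ, norm_zero]
      positivity

theorem fracInt_eq_kernelConv (S : ℝ → X →L[ℂ] X) {s : ℝ} (hs : 0 < s) (u : ℝ → X) :
    fracInt S s u = kernelConv (truncation S) (gammaKernel s) u := by
  funext t
  rw [fracInt, if_neg hs.ne', ← integral_smul, ← integral_indicator measurableSet_Ioi]
  refine integral_congr_ae (Filter.Eventually.of_forall fun τ => ?_)
  by_cases hτ : 0 < τ
  · simp only [indicator_of_mem (mem_Ioi.2 hτ), gammaKernel_of_pos hτ,
      truncation_apply_of_pos S hτ, smul_smul]
    ring_nf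
  · simp [hτ, truncation]

theorem fracInt_zero (S : ℝ → X →L[ℂ] X) (u : ℝ → X) : fracInt S 0 u = u := by
  funext t
  simp [fracInt]

theorem fracInt_congr {S : ℝ → X →L[ℂ] X} {s : ℝ} (hs : 0 ≤ s) {u v : ℝ → X}
    (h : u =ᵐ[volume] v) : fracInt S s u =ᵐ[volume] fracInt S s v := by
  rcases hs.eq_or_lt with rfl | hs
  · simpa [fracInt_zero] using h
  · rw [fracInt_eq_kernelConv S hs, fracInt_eq_kernelConv S hs, kernelConv_congr h]

variable {A : X →ₗ.[ℂ] X} {S : ℝ → X →L[ℂ] X} {M δ : ℝ}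

theorem WeightedIntegrable.fracIntConverges {u : ℝ → X} (hu : WeightedIntegrable δ u)
    (hT : IsDecaySemigroup (truncation S) M δ) {s : ℝ} (hs : 0 ≤ s) :
    FracIntConverges S s u := by
  rcases hs.eq_or_lt with rfl | hs
  · exact Or.inl rfl
  refine Or.inr ?_
  filter_upwards [hT.ae_integrable (isKernel_gammaKernel hT.pos hs) hu] with t ht
  refine IntegrableOn.congr_fun (Integrable.integrableOn (ht.smul (Real.Gamma s)))
    (fun τ hτ => ?_) measurableSet_Ioi
  have hΓ := (Real.Gamma_pos_of_pos hs).ne'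
  simp only [Pi.smul_apply, gammaKernel_of_pos hτ, truncation_apply_of_pos S hτ, smul_smul]
  rw [mul_div_cancel₀ _ hΓ]

theorem WeightedIntegrable.fracInt {u : ℝ → X} (hu : WeightedIntegrable δ u)
    (hT : IsDecaySemigroup (truncation S) M δ) {s : ℝ} (hs : 0 ≤ s) :
    WeightedIntegrable δ (fracInt S s u) := by
  rcases hs.eq_or_lt with rfl | hs
  · rwa [fracInt_zero]
  · rw [fracInt_eq_kernelConv S hs]
    exact hT.weightedIntegrable_kernelConv (isKernel_gammaKernel hT.pos hs) hu

/-- The semigroup property of the fractional parabolic integrals. -/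
theorem fracInt_fracInt [CompleteSpace X] (hT : IsDecaySemigroup (truncation S) M δ) {a b : ℝ}
    (ha : 0 ≤ a) (hb : 0 ≤ b) {u : ℝ → X} (hu : WeightedIntegrable δ u) :
    fracInt S a (fracInt S b u) =ᵐ[volume] fracInt S (a + b) u := by
  rcases ha.eq_or_lt with rfl | ha
  · rw [fracInt_zero, zero_add]
  rcases hb.eq_or_lt with rfl | hb
  · rw [fracInt_zero, add_zero]
  rw [fracInt_eq_kernelConv S ha, fracInt_eq_kernelConv S hb,
    fracInt_eq_kernelConv S (add_pos ha hb), ← gammaKernel_conv ha hb]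
  exact hT.kernelConv_kernelConv (isKernel_gammaKernel hT.pos ha) (isKernel_gammaKernel hT.pos hb)
    hu

/-- A single real resolvent point suffices; it is taken positive so that `a⁻¹` makes sense in the
resolvent identity. -/
theorem IsGenerator.exists_eq_iff (hA : IsGenerator (-A) S) : ∃ a : ℝ, 0 < a ∧
    ∀ x y : X, (∃ hy : y ∈ A.domain, a • y + A ⟨y, hy⟩ = x) ↔
      y = ∫ τ, expKernel a τ • truncation S τ x := by
  obtain ⟨a, ha⟩ := hA
  refine ⟨max a 0 + 1, by positivity, fun x y => ?_⟩
  set b : ℝ := max a 0 + 1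
  have hb : a < (b : ℂ).re := by
    rw [Complex.ofReal_re]
    exact (le_max_left a 0).trans_lt (lt_add_one _)
  have h := (ha b hb x).2 y
  have hint : ∫ t in Ioi (0 : ℝ), Complex.exp (-(b : ℂ) * (t : ℂ)) • S t x =
      ∫ τ, expKernel b τ • truncation S τ x := by
    rw [← integral_indicator measurableSet_Ioi]
    refine integral_congr_ae (Filter.Eventually.of_forall fun τ => ?_)
    by_cases hτ : 0 < τ
    · simp only [indicator_of_mem (mem_Ioi.2 hτ), expKernel, if_pos hτ,
        truncation_apply_of_pos S hτ, ← Complex.coe_smul]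
      push_cast
      rfl
    · simp [hτ, truncation]
  rw [← hint, ← h]
  refine exists_congr fun hy => ?_
  rw [LinearPMap.neg_apply, sub_neg_eq_add, Complex.coe_smul]

/-- Writing `R` for the Laplace transform at `a`, `J x = 0` forces `R x = 0` by the resolvent
identity, and `R x = 0` means `x = a 0 + A 0 = 0`. -/
theorem IsGenerator.integralOp_injective [CompleteSpace X] (hA : IsGenerator (-A) S)
    (hT : IsDecaySemigroup (truncation S) M δ) (x : X) (hx : hT.integralOp x = 0) : x = 0 := by
  obtain ⟨a, ha, h⟩ := hA.exists_eq_iff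
  have h1 := hT.integral_expKernel_integralOp ha x
  simp only [hx, map_zero, smul_zero, integral_zero, zero_sub, smul_neg] at h1
  have h2 : ∫ τ, expKernel a τ • truncation S τ x = 0 := by
    simpa [ha.ne'] using h1.symm
  obtain ⟨hy, h3⟩ := (h x 0).2 h2.symm
  rw [← h3, smul_zero, zero_add]
  exact A.map_zero

/-- With `x = a y + A y` and `y = R x`, the resolvent identity reads `a J y = a J y + J A y - y`. -/
theorem IsGenerator.integralOp_apply_generator [CompleteSpace X] (hA : IsGenerator (-A) S)
    (hT : IsDecaySemigroup (truncation S) M δ) {y : X} (hy : y ∈ A.domain) :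
    hT.integralOp (A ⟨y, hy⟩) = y := by
  obtain ⟨a, ha, h⟩ := hA.exists_eq_iff
  have h1 := (h _ y).1 ⟨hy, rfl⟩
  have h2 := hT.integralOp_integral_expKernel ha (a • y + A ⟨y, hy⟩)
  rw [← h1, map_add, map_smul] at h2
  have h3 := congrArg (a • ·) h2
  simp only [smul_smul, mul_inv_cancel₀ ha.ne', one_smul] at h3
  rw [add_sub_assoc, left_eq_add, sub_eq_zero] at h3
  exact h3

/-- The parabolic integral of order one is a left inverse of `∂_t + A`. -/
theorem IsParabolic.fracInt_one [CompleteSpace X] (hA : IsGenerator (-A) S)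
    (hT : IsDecaySemigroup (truncation S) M δ) {p : ℝ≥0∞} (hp : 1 ≤ p) {v f : ℝ → X}
    (h : IsParabolic A p v f) : fracInt S 1 f =ᵐ[volume] v := by
  obtain ⟨hv, v', g, ⟨hv', hd⟩, ⟨hg, hAg⟩, hf⟩ := h
  have hf' : f =ᵐ[volume] fun t => v' t + g t := hf
  rw [fracInt_eq_kernelConv S one_pos, kernelConv_congr hf']
  refine hT.kernelConv_one_add_of_weakDeriv (hA.integralOp_injective hT)
    (hv.weightedIntegrable hT.pos hp) (hv'.weightedIntegrable hT.pos hp)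
    (hg.weightedIntegrable hT.pos hp) hd ?_
  filter_upwards [hAg] with t ⟨ht, hgt⟩
  rw [← hgt, hA.integralOp_apply_generator hT]

theorem fracInt_one_injective [CompleteSpace X] (hA : IsGenerator (-A) S)
    (hT : IsDecaySemigroup (truncation S) M δ) {u v : ℝ → X} (hu : WeightedIntegrable δ u)
    (hv : WeightedIntegrable δ v) (h : fracInt S 1 u =ᵐ[volume] fracInt S 1 v) :
    u =ᵐ[volume] v := by
  rw [fracInt_eq_kernelConv S one_pos, fracInt_eq_kernelConv S one_pos] at h
  have h0 : (fun t => u t - v t) =ᵐ[volume] 0 := by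
    refine hT.ae_eq_zero_of_kernelConv_one (hA.integralOp_injective hT) (hu.sub hv) ?_
    filter_upwards [h, hT.ae_integrable_one hu, hT.ae_integrable_one hv] with t ht hut hvt
    rw [hT.kernelConv_gammaKernel_one, hT.kernelConv_gammaKernel_one] at ht
    rw [hT.kernelConv_gammaKernel_one]
    simp only [map_sub]
    rw [integral_sub hut hvt, ht, sub_self, Pi.zero_apply]
  filter_upwards [h0] with t ht
  exact sub_eq_zero.1 ht

theorem fracInt_natCast_injective [CompleteSpace X] (hA : IsGenerator (-A) S)
    (hT : IsDecaySemigroup (truncation S) M δ) (n : ℕ) {u v : ℝ → X} (hu : WeightedIntegrable δ u)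
    (hv : WeightedIntegrable δ v) (h : fracInt S n u =ᵐ[volume] fracInt S n v) :
    u =ᵐ[volume] v := by
  induction n with
  | zero => simpa [fracInt_zero] using h
  | succ n ih =>
    -- The order `1 + n` puts `𝓘¹` outermost, where it can be cancelled.
    rw [Nat.cast_succ, add_comm] at h
    exact ih (fracInt_one_injective hA hT (hu.fracInt hT n.cast_nonneg)
      (hv.fracInt hT n.cast_nonneg) ((fracInt_fracInt hT zero_le_one n.cast_nonneg hu).trans
        (h.trans (fracInt_fracInt hT zero_le_one n.cast_nonneg hv).symm)))

/-- Composing with `𝓘` of order `⌈a⌉ - a` raises the order to an integer, where cancellation is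
known. -/
theorem fracInt_injective [CompleteSpace X] (hA : IsGenerator (-A) S)
    (hT : IsDecaySemigroup (truncation S) M δ) {a : ℝ} (ha : 0 ≤ a) {u v : ℝ → X}
    (hu : WeightedIntegrable δ u) (hv : WeightedIntegrable δ v)
    (h : fracInt S a u =ᵐ[volume] fracInt S a v) : u =ᵐ[volume] v := by
  have hb : 0 ≤ (⌈a⌉₊ : ℝ) - a := sub_nonneg.2 (Nat.le_ceil a)
  have h1 := fracInt_fracInt hT hb ha hu
  have h2 := fracInt_fracInt hT hb ha hv
  rw [sub_add_cancel] at h1 h2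
  exact fracInt_natCast_injective hA hT ⌈a⌉₊ hu hv (h1.symm.trans ((fracInt_congr hb h).trans h2))

theorem IsParabolicPow.weightedIntegrable {p : ℝ≥0∞} (hp : 1 ≤ p) (hδ : 0 < δ) (n : ℕ) :
    ∀ {v f : ℝ → X}, IsParabolicPow A p n v f → WeightedIntegrable δ f := by
  induction n with
  | zero => exact fun h => (h.1.weightedIntegrable hδ hp).congr h.2.symm
  | succ n ih =>
    rintro v f ⟨g, -, hg⟩
    exact ih hg

theorem IsParabolicPow.fracInt_natCast [CompleteSpace X] (hA : IsGenerator (-A) S)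
    (hT : IsDecaySemigroup (truncation S) M δ) {p : ℝ≥0∞} (hp : 1 ≤ p) (n : ℕ) :
    ∀ {v f : ℝ → X}, IsParabolicPow A p n v f → fracInt S n f =ᵐ[volume] v := by
  induction n with
  | zero =>
    intro v f h
    rw [Nat.cast_zero, fracInt_zero]
    exact h.2
  | succ n ih =>
    rintro v f ⟨g, hvg, hgf⟩
    have h1 := fracInt_fracInt hT zero_le_one n.cast_nonneg (hgf.weightedIntegrable hp hT.pos)
    rw [Nat.cast_succ, add_comm]
    exact h1.symm.trans ((fracInt_congr zero_le_one (ih hgf)).trans (hvg.fracInt_one hA hT hp))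

end Complex

end FracParabolic

end

theorem proposition2p3 {X : Type*} [NormedAddCommGroup X] [NormedSpace ℂ X] [CompleteSpace X]
    (A : X →ₗ.[ℂ] X) (S : ℝ → X →L[ℂ] X)
    (hS : FracParabolic.IsMeasurableSemigroup S)
    (hA : FracParabolic.IsGenerator (-A) S)
    (hexp : FracParabolic.IsExpStable S)
    (s : ℝ) (hs : 0 ≤ s) (p : ℝ≥0∞) (hp : 1 ≤ p)
    (u : ℝ → X) (hu : MemLp u p volume) :
    FracParabolic.FracIntConverges S s u ∧
    (FracParabolic.InDomFracDeriv A S p s (FracParabolic.fracInt S s u) →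
      FracParabolic.fracDeriv A S p s (FracParabolic.fracInt S s u) =ᵐ[volume] u) ∧
    (FracParabolic.InDomFracDeriv A S p s u →
      FracParabolic.FracIntConverges S s (FracParabolic.fracDeriv A S p s u) ∧
      FracParabolic.fracInt S s (FracParabolic.fracDeriv A S p s u) =ᵐ[volume] u) := by
  obtain ⟨M, δ, hT⟩ := hS.exists_isDecaySemigroup hexp
  have hu' := hu.weightedIntegrable hT.pos hp
  have hα : 0 ≤ (⌈s⌉₊ : ℝ) - s := sub_nonneg.2 (Nat.le_ceil s)
  refine ⟨hu'.fracIntConverges hT hs, fun h => ?_, fun h => ?_⟩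
  · obtain ⟨-, -, hpow⟩ := FracParabolic.isFracDeriv_fracDeriv h
    have h1 := hpow.fracInt_natCast hA hT hp
    have h2 := FracParabolic.fracInt_fracInt hT hα hs hu'
    rw [sub_add_cancel] at h2
    exact FracParabolic.fracInt_natCast_injective hA hT _ (hpow.weightedIntegrable hp hT.pos) hu'
      (h1.trans h2)
  · obtain ⟨-, -, hpow⟩ := FracParabolic.isFracDeriv_fracDeriv h
    have hf := hpow.weightedIntegrable hp hT.pos
    have h1 := hpow.fracInt_natCast hA hT hp
    have h2 := FracParabolic.fracInt_fracInt hT hα hs hf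
    rw [sub_add_cancel] at h2
    exact ⟨hf.fracIntConverges hT hs, FracParabolic.fracInt_injective hA hT hα
      (hf.fracInt hT hs) hu' (h2.trans h1)⟩
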